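/- Fix a (finitary, single-sorted) algebraic signature, and let $\mathbb V$ be a quasi-variety of universal algebras of this signature, i.e. the class of all algebras satisfying some set of quasi-identities $s_1\approx t_1\wedge\dots\wedge s_n\approx t_n\Rightarrow s\approx t$ ($n\ge 0$). A relation $U\subseteq X\times Y$ between algebras $X,Y$ is *compatible* if it is a subalgebra of $X\times Y$; a *congruence* on $X$ is a compatible equivalence relation on $X$. For $X\in\mathbb V$, a relation $P$ on $X$ is *positive* if there are an algebra $Y\in\mathbb V$ and a compatible relation $U\subseteq X\times Y$ such that $P=U^\circ U$, that is, for all $x,x'\in X$: $(x,x')\in P$ if and only if $(x,y)\in U$ and $(x',y)\in U$ for some $y\in Y$. The following conditions are equivalent: 1. $\mathbb V$ is $3$-permutable: $RSR=SRS$ for all congruences $R$ and $S$ on the same algebra $X\in\mathbb V$. 2. The Shifting Lemma holds in $\mathbb V$ when $S$ is a reflexive compatible relation and $R$ and $T$ are reflexive and positive compatible relations: for every $X\in\mathbb V$ and all such relations $R,S,T$ on $X$ with $R\cap S\subseteq T$, whenever $x,y,u,v\in X$ satisfy $(x,y)\in R\cap T$, $(x,u)\in S$, $(y,v)\in S$ and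 $(u,v)\in R$, one has $(u,v)\in T$. -/

import Mathlib

universe u v w

namespace UniversalAlgebra

/-- A quasi-identity `s₁ ≈ t₁ ∧ … ∧ sₙ ≈ tₙ → s ≈ t` (with `n ≥ 0`) between terms of the language
`L` in a countable supply of variables; `n = 0` gives the identities. -/
structure QuasiIdentity (L : FirstOrder.Language.{u, v}) where
  /-- The finitely many equations in the premise. -/
  premises : List (L.Term ℕ × L.Term ℕ)
  /-- The equation in the conclusion. -/
  conclusion : L.Term ℕ × L.Term ℕ

/-- The algebra `A` satisfies the quasi-identity `q`: under every assignment of the variables for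
which all the equations of the premise hold, the equation of the conclusion holds. -/
def QuasiIdentity.Holds {L : FirstOrder.Language.{u, v}} (q : QuasiIdentity L)
    (A : Type w) [L.Structure A] : Prop :=
  ∀ a : ℕ → A, (∀ e ∈ q.premises, e.1.realize a = e.2.realize a) →
    q.conclusion.1.realize a = q.conclusion.2.realize a

/-- A class of algebras is a quasi-variety if it is the class of all algebras that satisfy some set
of quasi-identities. (For an algebraic language `L`, an `L`-structure is a universal algebra of
signature `L`.) -/
def IsQuasiVariety {L : FirstOrder.Language.{u, v}} (V : Set (CategoryTheory.Bundled.{w} L.Structure)) : Prop :=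
  ∃ Q : Set (QuasiIdentity L), V = {A : CategoryTheory.Bundled.{w} L.Structure | ∀ q ∈ Q, q.Holds A}

/-- A relation from `X` to `Y` is compatible if it is preserved by all the basic operations, i.e. if
it is a subalgebra of the product algebra `X × Y`. -/
def IsCompatible (L : FirstOrder.Language.{u, v}) {X Y : Type w} [L.Structure X] [L.Structure Y]
    (U : SetRel X Y) : Prop :=
  ∀ (n : ℕ) (f : L.Functions n) (x : Fin n → X) (y : Fin n → Y),
    (∀ i, (x i, y i) ∈ U) →
      (FirstOrder.Language.Structure.funMap f x, FirstOrder.Language.Structure.funMap f y) ∈ U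

/-- A congruence is a compatible equivalence relation. -/
structure IsCongruence (L : FirstOrder.Language.{u, v}) {X : Type w} [L.Structure X]
    (R : SetRel X X) : Prop where
  compatible : IsCompatible L R
  refl : R.IsRefl
  symm : R.IsSymm
  trans : R.IsTrans

/-- A relation `P` on `X` is positive in the class `V` if `P = U° U` for some algebra `Y` in `V` and
some compatible relation `U` from `X` to `Y`: one has `(x, x') ∈ P` if and only if `(x, y) ∈ U` and
`(x', y) ∈ U` for some `y`. (`SetRel.comp` composes from left to right.) -/
def IsPositive {L : FirstOrder.Language.{u, v}} (V : Set (CategoryTheory.Bundled.{w} L.Structure))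
    {X : Type w} [L.Structure X] (P : SetRel X X) : Prop :=
  ∃ Y ∈ V, ∃ U : SetRel X Y, IsCompatible L U ∧ P = U.comp U.inv

/-- `V` is 3-permutable: `R S R = S R S` for all congruences `R`, `S` on an algebra of `V`. -/
def IsThreePermutable {L : FirstOrder.Language.{u, v}} (V : Set (CategoryTheory.Bundled.{w} L.Structure)) : Prop :=
  ∀ X ∈ V, ∀ R S : SetRel X X, IsCongruence L R → IsCongruence L S →
    (R.comp S).comp R = (S.comp R).comp S

/-- The property expressed by the Shifting Lemma for three relations `R`, `S`, `T` on a set: if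
`R ∧ S ≤ T`, then the diagram
```
  x --S-- u
  |       |
 R,T      R   (read from left to right and from top to bottom)
  |       |
  y --S-- v
```
implies `(u, v) ∈ T`. -/
def Shifts {X : Type w} (R S T : SetRel X X) : Prop :=
  R ∩ S ⊆ T → ∀ x y u v : X,
    (x, y) ∈ R ∩ T → (x, u) ∈ S → (y, v) ∈ S → (u, v) ∈ R → (u, v) ∈ T

/-- The Shifting Lemma holds in `V` when `S` is a reflexive compatible relation, and `R` and `T` are
reflexive and positive compatible relations. -/
def PositiveShiftingLemma {L : FirstOrder.Language.{u, v}} (V : Set (CategoryTheory.Bundled.{w} L.Structure)) : Prop :=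
  ∀ X ∈ V, ∀ R S T : SetRel X X,
    IsCompatible L R → R.IsRefl → IsPositive V R →
    IsCompatible L S → S.IsRefl →
    IsCompatible L T → T.IsRefl → IsPositive V T →
    Shifts R S T

end UniversalAlgebra

namespace UniversalAlgebra

open FirstOrder.Language
open scoped FirstOrder

section Relations

variable {L : FirstOrder.Language.{u, v}} {X Y Z : Type w} [L.Structure X] [L.Structure Y]
  [L.Structure Z]

/-! Viewing a compatible `U` as a subalgebra of `X × Y`, 3-permutability of the two projection
kernels gives `U U° U U° ≤ U U°` (`exists_common_image`), so reflexive positive relations are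
congruences. The Shifting Lemma follows by applying this to one auxiliary relation from `X × X` to
`X`. Conversely, for congruences `R`, `S`, both `RSR` and `SRS` are positive, and shifting along `R`
carries `RSR` into `SRS`. -/

theorem IsCompatible.comp {U : SetRel X Y} {W : SetRel Y Z} (hU : IsCompatible L U)
    (hW : IsCompatible L W) : IsCompatible L (U.comp W) := by
  intro n f x z h
  choose y hy hz using h
  exact ⟨_, hU n f x y hy, hW n f y z hz⟩

/-- The kernel of a homomorphism is a congruence. -/
theorem isCongruence_ker (f : X →[L] Y) :
    IsCongruence L {p : X × X | f p.1 = f p.2} where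
  compatible n g x y h := by
    have h' : ∀ i, f (x i) = f (y i) := h
    change f _ = f _
    rw [f.map_fun, f.map_fun]
    exact congrArg _ (funext h')
  refl := ⟨fun _ => rfl⟩
  symm := ⟨fun _ _ h => Eq.symm h⟩
  trans := ⟨fun _ _ _ h h' => Eq.trans h h'⟩

end Relations

/-- The product of two algebras. -/
@[reducible]
def prodStructure (L : FirstOrder.Language.{u, v}) (X Y : Type w) [L.Structure X]
    [L.Structure Y] : L.Structure (X × Y) where
  funMap f x := (Structure.funMap f fun i => (x i).1, Structure.funMap f fun i => (x i).2)
  RelMap r x := (Structure.RelMap r fun i => (x i).1) ∧ (Structure.RelMap r fun i => (x i).2)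

attribute [local instance] prodStructure

/-- The first projection of a product of algebras. -/
def fstHom (L : FirstOrder.Language.{u, v}) (X Y : Type w) [L.Structure X] [L.Structure Y] :
    (X × Y) →[L] X where
  toFun := Prod.fst
  map_fun' _ _ := rfl
  map_rel' _ _ h := h.1

/-- The second projection of a product of algebras. -/
def sndHom (L : FirstOrder.Language.{u, v}) (X Y : Type w) [L.Structure X] [L.Structure Y] :
    (X × Y) →[L] Y where
  toFun := Prod.snd
  map_fun' _ _ := rfl
  map_rel' _ _ h := h.2

/-- A compatible relation as a subalgebra of the product. -/
def IsCompatible.substructure {L : FirstOrder.Language.{u, v}} {X Y : Type w} [L.Structure X]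
    [L.Structure Y] {U : SetRel X Y} (hU : IsCompatible L U) : L.Substructure (X × Y) where
  carrier := U
  fun_mem f _ h := hU _ f _ _ h

section QuasiVariety

variable {L : FirstOrder.Language.{u, v}} {V : Set (CategoryTheory.Bundled.{w} L.Structure)}

/-- A quasi-variety contains every algebra with two jointly injective homomorphisms to members. -/
theorem IsQuasiVariety.mem_of_jointly_injective (hV : IsQuasiVariety V)
    {A X Y : Type w} [hA : L.Structure A] [hX : L.Structure X] [hY : L.Structure Y]
    (hXV : (⟨X, hX⟩ : CategoryTheory.Bundled.{w} L.Structure) ∈ V)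
    (hYV : (⟨Y, hY⟩ : CategoryTheory.Bundled.{w} L.Structure) ∈ V)
    (f : A →[L] X) (g : A →[L] Y) (hfg : ∀ a b, f a = f b → g a = g b → a = b) :
    (⟨A, hA⟩ : CategoryTheory.Bundled.{w} L.Structure) ∈ V := by
  obtain ⟨Q, rfl⟩ := hV
  intro q hq a ha
  -- Homomorphisms preserve the premises; joint injectivity reflects the conclusion.
  apply hfg
  · rw [← HomClass.realize_term f, ← HomClass.realize_term f]
    refine hXV q hq _ fun e he => ?_
    rw [HomClass.realize_term f, HomClass.realize_term f]
    exact congrArg f (ha e he)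
  · rw [← HomClass.realize_term g, ← HomClass.realize_term g]
    refine hYV q hq _ fun e he => ?_
    rw [HomClass.realize_term g, HomClass.realize_term g]
    exact congrArg g (ha e he)

theorem IsQuasiVariety.prod_mem (hV : IsQuasiVariety V) {X Y : Type w}
    [hX : L.Structure X] [hY : L.Structure Y]
    (hXV : (⟨X, hX⟩ : CategoryTheory.Bundled.{w} L.Structure) ∈ V)
    (hYV : (⟨Y, hY⟩ : CategoryTheory.Bundled.{w} L.Structure) ∈ V) :
    (⟨X × Y, prodStructure L X Y⟩ : CategoryTheory.Bundled.{w} L.Structure) ∈ V :=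
  hV.mem_of_jointly_injective hXV hYV (fstHom L X Y) (sndHom L X Y)
    fun _ _ h h' => Prod.ext h h'

/-- In a 3-permutable quasi-variety, every compatible relation satisfies `U U° U U° ≤ U U°`. -/
theorem IsThreePermutable.exists_common_image (hP : IsThreePermutable V) (hV : IsQuasiVariety V)
    {X Y : Type w} [hX : L.Structure X] [hY : L.Structure Y]
    (hXV : (⟨X, hX⟩ : CategoryTheory.Bundled.{w} L.Structure) ∈ V)
    (hYV : (⟨Y, hY⟩ : CategoryTheory.Bundled.{w} L.Structure) ∈ V)
    {U : SetRel X Y} (hU : IsCompatible L U) {a b c : X} {y z : Y}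
    (hay : (a, y) ∈ U) (hby : (b, y) ∈ U) (hbz : (b, z) ∈ U) (hcz : (c, z) ∈ U) :
    ∃ t, (a, t) ∈ U ∧ (c, t) ∈ U := by
  let A := hU.substructure
  let f : A →[L] X := (fstHom L X Y).comp A.subtype.toHom
  let g : A →[L] Y := (sndHom L X Y).comp A.subtype.toHom
  have hA : (⟨A, inferInstance⟩ : CategoryTheory.Bundled.{w} L.Structure) ∈ V :=
    hV.mem_of_jointly_injective hXV hYV f g fun _ _ h h' => Subtype.ext (Prod.ext h h')
  have key := hP _ hA _ _ (isCongruence_ker f) (isCongruence_ker g)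
  have hmem : ((⟨(a, y), hay⟩ : A), (⟨(c, z), hcz⟩ : A)) ∈
      (SetRel.comp {p : A × A | g p.1 = g p.2} {p : A × A | f p.1 = f p.2}).comp
        {p : A × A | g p.1 = g p.2} :=
    -- The path `(a, y)`, `(b, y)`, `(b, z)`, `(c, z)` alternates the kernels; swapping their roles
    -- forces a path through `(a, t)` and `(c, t)`.
    ⟨⟨(b, z), hbz⟩, ⟨⟨(b, y), hby⟩, rfl, rfl⟩, rfl⟩
  obtain ⟨⟨⟨c', t'⟩, h₂⟩, ⟨⟨⟨a', t⟩, h₁⟩, h, h'⟩, h''⟩ := key.ge hmem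
  obtain rfl : a = a' := h
  obtain rfl : t = t' := h'
  obtain rfl : c' = c := h''
  exact ⟨t, h₁, h₂⟩

/-- In a 3-permutable quasi-variety, positive relations are transitive. -/
theorem IsPositive.trans (hP : IsThreePermutable V) (hV : IsQuasiVariety V) {X : Type w}
    [hX : L.Structure X] (hXV : (⟨X, hX⟩ : CategoryTheory.Bundled.{w} L.Structure) ∈ V)
    {T : SetRel X X} (hT : IsPositive V T) {a b c : X} (hab : (a, b) ∈ T) (hbc : (b, c) ∈ T) :
    (a, c) ∈ T := by
  obtain ⟨Y, hY, U, hU, rfl⟩ := hT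
  obtain ⟨y, hay, hby⟩ := hab
  obtain ⟨z, hbz, hcz⟩ := hbc
  exact hP.exists_common_image hV hXV hY hU hay hby hbz hcz

theorem IsPositive.symm {X : Type w} [L.Structure X] {T : SetRel X X} (hT : IsPositive V T)
    {a b : X} (hab : (a, b) ∈ T) : (b, a) ∈ T := by
  obtain ⟨Y, hY, U, hU, rfl⟩ := hT
  obtain ⟨y, hay, hby⟩ := hab
  exact ⟨y, hby, hay⟩

theorem IsThreePermutable.positiveShiftingLemma (hP : IsThreePermutable V)
    (hV : IsQuasiVariety V) : PositiveShiftingLemma V := by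
  intro X hX R S T hRc hRr hRp hSc hSr hTc hTr hTp hRST x y u v hxy hxu hyv huv
  have rR (a : X) : (a, a) ∈ R := hRr.refl a
  have rS (a : X) : (a, a) ∈ S := hSr.refl a
  have rT (a : X) : (a, a) ∈ T := hTr.refl a
  -- The first coordinate follows `R ∩ T` and then `S`, the second follows `R`, towards a common
  -- target.
  let W : SetRel (X × X) X :=
    {p | (p.1.2, p.2) ∈ R ∧ ∃ z, (p.1.1, z) ∈ R ∧ (p.1.1, z) ∈ T ∧ (z, p.2) ∈ S}
  have hW : IsCompatible L W := by
    intro n f p q h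
    choose h₁ z h₂ h₃ h₄ using h
    exact ⟨hRc n f _ _ h₁, _, hRc n f _ _ h₂, hTc n f _ _ h₃, hSc n f _ _ h₄⟩
  -- On the diagonal `z R a R q` and `z S q`, so `R ∩ S ⊆ T` gives `a T z T q`.
  have hWT {a q : X} (h : ((a, a), q) ∈ W) : (a, q) ∈ T := by
    obtain ⟨haq, z, hazR, hazT, hzq⟩ := h
    exact hTp.trans hP hV hX hazT
      (hRST ⟨hRp.trans hP hV hX (hRp.symm hazR) haq, hzq⟩)
  -- The pair `(x, u)` reaches both `u` and `v`, the latter through `y`, linking the diagonal pairs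
  -- of `u` and `v`.
  obtain ⟨t, hut, hvt⟩ := hP.exists_common_image hV (hV.prod_mem hX hX) hX hW
    (a := (u, u)) (b := (x, u)) (c := (v, v)) (y := u) (z := v)
    ⟨rR u, u, rR u, rT u, rS u⟩ ⟨rR u, x, rR x, rT x, hxu⟩
    ⟨huv, y, hxy.1, hxy.2, hyv⟩ ⟨rR v, v, rR v, rT v, rS v⟩
  exact hTp.trans hP hV hX (hWT hut) (hTp.symm (hWT hvt))

/-- If `R` and `S` are congruences then `R S R = (R S) (R S)°` is positive. -/
theorem isPositive_comp_comp {X : CategoryTheory.Bundled.{w} L.Structure} (hX : X ∈ V)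
    {R S : SetRel X X} (hR : IsCongruence L R) (hS : IsCongruence L S) :
    IsPositive V ((R.comp S).comp R) := by
  refine ⟨X, hX, R.comp S, hR.compatible.comp hS.compatible, ?_⟩
  ext ⟨a, b⟩
  constructor
  · rintro ⟨d, ⟨c, hac, hcd⟩, hdb⟩
    exact ⟨d, ⟨c, hac, hcd⟩, d, hR.symm.symm _ _ hdb, hS.refl.refl d⟩
  · rintro ⟨d, ⟨c, hac, hcd⟩, e, hbe, hed⟩
    exact ⟨e, ⟨c, hac, hS.trans.trans _ _ _ hcd (hS.symm.symm _ _ hed)⟩, hR.symm.symm _ _ hbe⟩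

theorem PositiveShiftingLemma.comp_comp_subset (h : PositiveShiftingLemma V)
    {X : CategoryTheory.Bundled.{w} L.Structure} (hX : X ∈ V)
    {R S : SetRel X X} (hR : IsCongruence L R) (hS : IsCongruence L S) :
    (R.comp S).comp R ⊆ (S.comp R).comp S := by
  have rR (a : X) : (a, a) ∈ R := hR.refl.refl a
  have rS (a : X) : (a, a) ∈ S := hS.refl.refl a
  rintro ⟨u, v⟩ ⟨y, ⟨x, hux, hxy⟩, hyv⟩
  -- The roles of `R`, `S`, `T` are played by `RSR`, `R`, `SRS`; the inclusion to check holds since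
  -- `R ⊆ SRS`.
  refine h X hX ((R.comp S).comp R) R ((S.comp R).comp S)
    ((hR.compatible.comp hS.compatible).comp hR.compatible)
    ⟨fun a => ⟨a, ⟨a, rR a, rS a⟩, rR a⟩⟩ (isPositive_comp_comp hX hR hS)
    hR.compatible hR.refl
    ((hS.compatible.comp hR.compatible).comp hS.compatible)
    ⟨fun a => ⟨a, ⟨a, rS a, rR a⟩, rS a⟩⟩ (isPositive_comp_comp hX hS hR)
    ?_ x y u v ⟨⟨y, ⟨x, rR x, hxy⟩, rR y⟩, ⟨x, ⟨x, rS x, rR x⟩, hxy⟩⟩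
    (hR.symm.symm _ _ hux) hyv ⟨y, ⟨x, hux, hxy⟩, hyv⟩
  rintro ⟨a, b⟩ ⟨-, hab⟩
  exact ⟨b, ⟨a, rS a, hab⟩, rS b⟩

end QuasiVariety

end UniversalAlgebra

theorem corollary3p8 {L : FirstOrder.Language.{u, v}} [L.IsAlgebraic]
    (V : Set (CategoryTheory.Bundled.{w} L.Structure)) (hV : UniversalAlgebra.IsQuasiVariety V) :
    UniversalAlgebra.IsThreePermutable V ↔ UniversalAlgebra.PositiveShiftingLemma V :=
  ⟨fun h => h.positiveShiftingLemma hV, fun h _ hX _ _ hR hS =>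
    (h.comp_comp_subset hX hR hS).antisymm (h.comp_comp_subset hX hS hR)⟩
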